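/- Let $(\mathcal{X},d)$ be a metric space and let $k,\Delta\in\mathbb{N}$. For finite sets $P,C\subseteq\mathcal{X}$ put $\mathrm{COST}(P,C)=\max_{p\in P}d(p,C)$, where $d(p,C)=\min_{c\in C}d(p,c)$ (with $d(p,\emptyset)=\infty$, and with cost $0$ if $P=\emptyset$), and let $\mathrm{OPT}_k(P)=\inf\{\mathrm{COST}(P,C) : C\subseteq\mathcal{X},\ |C|\le k\}$. There is a rule (depending only on $(\mathcal{X},d)$, $k$ and $\Delta$) that assigns to every finite sequence $P_1,\dots,P_i$ of finite subsets of $\mathcal{X}$ a finite set $C_i=C_i(P_1,\dots,P_i)\subseteq\mathcal{X}$, such that the following holds for every $n\in\mathbb{N}$ and every sequence $P_1,\dots,P_n$ of finite subsets of $\mathcal{X}$ for which any two distinct points of the same $P_i$ are at distance at least $1$ and at most $\Delta$ and $|P_i\triangle P_{i+1}|=1$ for all $1\le i<n$. (i) For every $1\le i\le n$: $C_i\subseteq P_i$, $|C_i|\le k$, and $\mathrm{COST}(P_i,C_i)\le 24\cdot\mathrm{OPT}_k(P_i)$. (ii) For every $1\le i<n$: if $P_{i+1}\setminus P_i\ne\emptyset$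 (an insertion), then $|C_i\triangle C_{i+1}|\le 2$; if $P_i\setminus P_{i+1}\ne\emptyset$ (a deletion), then $|C_i\triangle C_{i+1}|\le 4$. -/

import Mathlib

open scoped ENNReal

namespace DynamicKCenter

/-- The `k`-center cost `max_{p ∈ P} d(p, C)` of the centers `C` for the point set `P`, where
`d(p, C) = min_{c ∈ C} d(p, c)`. It takes values in `[0, ∞]`: the distance to the empty set of
centers is `∞`, and the cost of an empty point set is `0`. -/
noncomputable def cost {X : Type*} [MetricSpace X] (P C : Finset X) : ℝ≥0∞ :=
  ⨆ p ∈ P, Metric.infEDist p (C : Set X)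

/-- The optimal `k`-center cost of `P`, over all sets of at most `k` centers in the whole
space (the centers need not lie in `P`). -/
noncomputable def opt {X : Type*} [MetricSpace X] (k : ℕ) (P : Finset X) : ℝ≥0∞ :=
  ⨅ (C : Finset X) (_ : C.card ≤ k), cost P C

/-- `P 1, …, P n` is a sequence of finite point sets in which distinct points of the same set are
at distance at least `1` and at most `Δ`, and in which any two consecutive sets differ by exactly
one point. The values of `P` outside `{1, …, n}` are irrelevant. -/
structure IsUpdateSequence {X : Type*} [MetricSpace X] [DecidableEq X] (Δ n : ℕ)
    (P : ℕ → Finset X) : Prop where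
  one_le_dist : ∀ i, 1 ≤ i → i ≤ n → ∀ p ∈ P i, ∀ q ∈ P i, p ≠ q → 1 ≤ dist p q
  dist_le : ∀ i, 1 ≤ i → i ≤ n → ∀ p ∈ P i, ∀ q ∈ P i, p ≠ q → dist p q ≤ (Δ : ℝ)
  card_symmDiff : ∀ i, 1 ≤ i → i < n → (symmDiff (P i) (P (i + 1))).card = 1

end DynamicKCenter

/-! Over `P` sits an infinite hierarchy in which level `j + 1` is a net of level `j` at radius `2 ^
(j + 1)`. If level `i` has more than `k` points, their separation `2 ^ i` forces an optimum of at
least `2 ^ i / 2` by pigeonhole, while level `i + 1` is within `4 * 2 ^ (i + 1)` of all of `P`. So a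
`k`-set between consecutive levels whose sizes straddle `k` is a constant-factor solution.

The difficulty is stability: a deleted net point leaves points uncovered, and repairs could multiply
from level to level. Virtual locations prevent this: `s` covers the `r`-balls about both `s` and `z
s`. When `q` disappears, each of its two balls is repaired by at most one of its points, whose
virtual location is the centre of the ball. The new points are within `2 * r` of `q`, the radius of
the next level, so there they fall into the ball about `q`. Hence every level loses at most `q` and
gains at most two points (`IsNet.exists_deletion`), while an insertion adds at most the inserted
point to each level (`IsNet.exists_insertion`). By `exists_between_card_symmDiff_le`, one exchange
of centers per insertion and two per deletion suffice. -/

namespace DynamicKCenter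

/-! ### Nets with virtual locations -/

/-- `y` is within `r` of a point of `I` or of the virtual location of such a point. -/
def Covered {X : Type*} [MetricSpace X] (r : ℝ) (I : Finset X) (z : X → X) (y : X) : Prop :=
  ∃ s ∈ I, dist y s ≤ r ∨ dist y (z s) ≤ r

/-- A subset `I` of `Y` whose distinct points are more than `r` apart, in which every point `s` has a
virtual location `z s` at distance at most `r`. -/
structure IsPacking {X : Type*} [MetricSpace X] (r : ℝ) (Y I : Finset X) (z : X → X) : Prop where
  subset : I ⊆ Y
  sep : ∀ s ∈ I, ∀ t ∈ I, s ≠ t → r < dist s t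
  loc : ∀ s ∈ I, dist s (z s) ≤ r

/-- A packing whose points and virtual locations cover `Y` within `r`. -/
structure IsNet {X : Type*} [MetricSpace X] (r : ℝ) (Y I : Finset X) (z : X → X) : Prop
    extends IsPacking r Y I z where
  covered : ∀ y ∈ Y, Covered r I z y

section Net

variable {X : Type*} [MetricSpace X] [DecidableEq X]

/-- A packing can be made to cover a subset of a ball of radius `r` by adding at most one point. -/
theorem IsPacking.exists_cover {r : ℝ} {Y I B : Finset X} {z : X → X} {w : X}
    (h : IsPacking r Y I z) (hB : B ⊆ Y) (hw : ∀ b ∈ B, dist b w ≤ r) :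
    ∃ I' z', IsPacking r Y I' z' ∧ I ⊆ I' ∧ I' \ I ⊆ B ∧ (I' \ I).card ≤ 1 ∧
      (∀ y, Covered r I z y → Covered r I' z' y) ∧ ∀ b ∈ B, Covered r I' z' b := by
  by_cases hc : ∀ b ∈ B, Covered r I z b
  · exact ⟨I, z, h, subset_rfl, by simp, by simp, fun _ hy => hy, hc⟩
  push Not at hc
  obtain ⟨b, hb, hbc⟩ := hc
  have hbI : b ∉ I := fun hbI => hbc ⟨b, hbI, Or.inl (by simpa using (dist_nonneg.trans (hw b hb)))⟩
  have hfar : ∀ s ∈ I, r < dist b s := fun s hs =>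
    lt_of_not_ge fun hle => hbc ⟨s, hs, Or.inl hle⟩
  have hne : ∀ s ∈ I, s ≠ b := fun s hs e => hbI (e ▸ hs)
  have hd : insert b I \ I ⊆ {b} := by
    intro x hx
    simp only [Finset.mem_sdiff, Finset.mem_insert] at hx
    simpa using hx.1.resolve_right hx.2
  -- An uncovered `b` is more than `r` from all of `I`, so separation survives; through the virtual
  -- location `w`, the single point `b` covers all of `B`.
  refine ⟨insert b I, Function.update z b w, ⟨?_, ?_, ?_⟩, Finset.subset_insert _ _,
    hd.trans (by simpa using hb), (Finset.card_le_card hd).trans (by simp), ?_, ?_⟩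
  · exact Finset.insert_subset (hB hb) h.subset
  · intro s hs t ht hst
    rcases Finset.mem_insert.1 hs with hsb | hsI <;> rcases Finset.mem_insert.1 ht with htb | htI
    · exact absurd (hsb.trans htb.symm) hst
    · rw [hsb]; exact hfar t htI
    · rw [htb, dist_comm]; exact hfar s hsI
    · exact h.sep s hsI t htI hst
  · intro s hs
    rcases Finset.mem_insert.1 hs with rfl | hs
    · simpa using hw s hb
    · simpa [Function.update_of_ne (hne s hs)] using h.loc s hs
  · rintro y ⟨s, hs, hy⟩
    exact ⟨s, Finset.mem_insert_of_mem hs, by simpa [Function.update_of_ne (hne s hs)] using hy⟩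
  · intro y hy
    exact ⟨b, Finset.mem_insert_self _ _, Or.inr (by simpa using hw y hy)⟩

/-- A packing can be made to cover `A` by adding points of `A`. -/
theorem IsPacking.exists_cover_subset {r : ℝ} (hr : 0 ≤ r) {Y I : Finset X} {z : X → X}
    (h : IsPacking r Y I z) (A : Finset X) (hA : A ⊆ Y) :
    ∃ I' z', IsPacking r Y I' z' ∧ I ⊆ I' ∧ I' \ I ⊆ A ∧
      (∀ y, Covered r I z y → Covered r I' z' y) ∧ ∀ a ∈ A, Covered r I' z' a := by
  induction A using Finset.induction_on with
  | empty => exact ⟨I, z, h, subset_rfl, by simp, fun _ hy => hy, by simp⟩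
  | insert a A _ ih =>
    obtain ⟨I₁, z₁, h₁, hI₁, hd₁, hm₁, hc₁⟩ := ih ((Finset.subset_insert _ _).trans hA)
    obtain ⟨I₂, z₂, h₂, hI₂, hd₂, -, hm₂, hc₂⟩ := h₁.exists_cover (B := {a}) (w := a)
      (by simpa using hA (Finset.mem_insert_self _ _)) (by simpa using hr)
    refine ⟨I₂, z₂, h₂, hI₁.trans hI₂, ?_, fun y hy => hm₂ y (hm₁ y hy), ?_⟩
    · intro x hx
      rw [Finset.mem_sdiff] at hx
      by_cases hx₁ : x ∈ I₁
      · exact Finset.mem_insert_of_mem (hd₁ (Finset.mem_sdiff.2 ⟨hx₁, hx.2⟩))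
      · have := hd₂ (Finset.mem_sdiff.2 ⟨hx.1, hx₁⟩)
        rw [Finset.mem_singleton.1 this]
        exact Finset.mem_insert_self _ _
    · intro y hy
      rcases Finset.mem_insert.1 hy with rfl | hy
      · exact hc₂ _ (Finset.mem_singleton_self _)
      · exact hm₂ y (hc₁ y hy)

theorem exists_isNet {r : ℝ} (hr : 0 ≤ r) (Y : Finset X) : ∃ I z, IsNet r Y I z := by
  have h : IsPacking r Y ∅ id := ⟨by simp, by simp, by simp⟩
  obtain ⟨I, z, hI, -, -, -, hc⟩ := h.exists_cover_subset hr Y subset_rfl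
  exact ⟨I, z, hI, hc⟩

/-- `Y'` is `Y`, possibly with the point `p` added. -/
def IsInsertion (p : X) (Y Y' : Finset X) : Prop :=
  Y ⊆ Y' ∧ Y' ⊆ insert p Y

/-- `Y'` is `Y` without `q`, with at most two points at distance at most `ρ` from `q` added. -/
structure IsDeletion (q : X) (ρ : ℝ) (Y Y' : Finset X) : Prop where
  erase_subset : Y.erase q ⊆ Y'
  notMem : q ∉ Y'
  card_le : (Y' \ Y).card ≤ 2
  dist_le : ∀ a ∈ Y' \ Y, dist a q ≤ ρ

theorem IsNet.exists_insertion {r : ℝ} (hr : 0 ≤ r) {Y Y' I : Finset X} {z : X → X} {p : X}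
    (h : IsNet r Y I z) (hY : IsInsertion p Y Y') :
    ∃ I' z', IsNet r Y' I' z' ∧ IsInsertion p I I' := by
  have h' : IsPacking r Y' I z := ⟨h.subset.trans hY.1, h.sep, h.loc⟩
  obtain ⟨I', z', hI', hsub, hd, hm, hc⟩ :=
    h'.exists_cover_subset hr (Y' \ Y) Finset.sdiff_subset
  refine ⟨I', z', ⟨hI', fun y hy => ?_⟩, hsub, fun x hx => ?_⟩
  · by_cases hyY : y ∈ Y
    · exact hm y (h.covered y hyY)
    · exact hc y (Finset.mem_sdiff.2 ⟨hy, hyY⟩)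
  · by_cases hxI : x ∈ I
    · exact Finset.mem_insert_of_mem hxI
    · have hx' := Finset.mem_sdiff.1 (hd (Finset.mem_sdiff.2 ⟨hx, hxI⟩))
      rcases Finset.mem_insert.1 (hY.2 hx'.1) with rfl | hxY
      · exact Finset.mem_insert_self _ _
      · exact absurd hxY hx'.2

theorem IsNet.exists_deletion {r : ℝ} (hr : 0 ≤ r) {Y Y' I : Finset X} {z : X → X} {q : X}
    (h : IsNet r Y I z) (hY : IsDeletion q r Y Y') :
    ∃ I' z', IsNet r Y' I' z' ∧ IsDeletion q (2 * r) I I' := by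
  have h₀ : IsPacking r Y' (I.erase q) z :=
    ⟨(Finset.erase_subset_erase q h.subset).trans hY.erase_subset,
      fun s hs t ht => h.sep s (Finset.mem_of_mem_erase hs) t (Finset.mem_of_mem_erase ht),
      fun s hs => h.loc s (Finset.mem_of_mem_erase hs)⟩
  by_cases hq : q ∈ I
  -- Points that `q` covered lie in the ball about `z q` or the ball about `q`; points new in `Y'`
  -- lie in the latter. One added point per ball is enough.
  · obtain ⟨I₁, z₁, h₁, hI₁, hd₁, hk₁, hm₁, hc₁⟩ :=
      h₀.exists_cover (B := Y'.filter fun y => dist y (z q) ≤ r) (w := z q)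
        (Finset.filter_subset _ _) (by simp)
    obtain ⟨I₂, z₂, h₂, hI₂, hd₂, hk₂, hm₂, hc₂⟩ :=
      h₁.exists_cover (B := Y'.filter fun y => dist y q ≤ r) (w := q)
        (Finset.filter_subset _ _) (by simp)
    have hq₂ : q ∉ I₂ := fun hq₂ => hY.notMem (h₂.subset hq₂)
    have hsplit : I₂ \ I ⊆ (I₁ \ I.erase q) ∪ (I₂ \ I₁) := by
      intro x hx
      simp only [Finset.mem_union, Finset.mem_sdiff, Finset.mem_erase] at hx ⊢
      tauto
    refine ⟨I₂, z₂, ⟨h₂, fun y hy => ?_⟩, hI₁.trans hI₂, hq₂, ?_, fun a ha => ?_⟩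
    · by_cases hyY : y ∈ Y
      · obtain ⟨s, hs, hys⟩ := h.covered y hyY
        by_cases hsq : s = q
        · subst hsq
          rcases hys with hys | hys
          · exact hc₂ y (Finset.mem_filter.2 ⟨hy, hys⟩)
          · exact hm₂ y (hc₁ y (Finset.mem_filter.2 ⟨hy, hys⟩))
        · exact hm₂ y (hm₁ y ⟨s, Finset.mem_erase.2 ⟨hsq, hs⟩, hys⟩)
      · exact hc₂ y (Finset.mem_filter.2 ⟨hy, hY.dist_le y (Finset.mem_sdiff.2 ⟨hy, hyY⟩)⟩)
    · have := (Finset.card_le_card hsplit).trans (Finset.card_union_le _ _)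
      omega
    · rcases Finset.mem_union.1 (hsplit ha) with ha | ha
      · have h₃ := (Finset.mem_filter.1 (hd₁ ha)).2
        have h₄ := h.loc q hq
        rw [dist_comm] at h₄
        linarith [dist_triangle a (z q) q]
      · have h₃ := (Finset.mem_filter.1 (hd₂ ha)).2
        linarith
  -- Here no cover is lost, so only the at most two new points of `Y'` may have to enter.
  · rw [Finset.erase_eq_of_notMem hq] at h₀
    obtain ⟨I', z', h', hI', hd, hm, hc⟩ :=
      h₀.exists_cover_subset hr (Y' \ Y) Finset.sdiff_subset
    refine ⟨I', z', ⟨h', fun y hy => ?_⟩, (Finset.erase_subset _ _).trans hI',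
      fun hq' => hY.notMem (h'.subset hq'), (Finset.card_le_card hd).trans hY.card_le,
      fun a ha => ?_⟩
    · by_cases hyY : y ∈ Y
      · exact hm y (h.covered y hyY)
      · exact hc y (Finset.mem_sdiff.2 ⟨hy, hyY⟩)
    · linarith [hY.dist_le a (hd ha)]

end Net

/-! ### Hierarchies of nets -/

/-- Dependent choice along the natural numbers, with prescribed start. -/
theorem exists_seq_of_step {α : Type*} {R : ℕ → α → Prop} {T : ℕ → α → α → Prop} {a : α}
    (h₀ : R 0 a) (hs : ∀ n a, R n a → ∃ b, R (n + 1) b ∧ T n a b) :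
    ∃ f : ℕ → α, f 0 = a ∧ (∀ n, R n (f n)) ∧ ∀ n, T n (f n) (f (n + 1)) := by
  choose g hg using hs
  let F : (n : ℕ) → {a // R n a} := fun n =>
    Nat.rec ⟨a, h₀⟩ (fun n b => ⟨g n b.1 b.2, (hg n b.1 b.2).1⟩) n
  exact ⟨fun n => (F n).1, rfl, fun n => (F n).2, fun n => (hg n (F n).1 (F n).2).2⟩

/-- Each set of the sequence `net` is a net of the previous one, at scale doubling in each step. -/
def IsHierarchy {X : Type*} [MetricSpace X] (net : ℕ → Finset X) (loc : ℕ → X → X) : Prop :=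
  ∀ j, IsNet ((2 : ℝ) ^ (j + 1)) (net j) (net (j + 1)) (loc (j + 1))

section Hierarchy

variable {X : Type*} [MetricSpace X]

theorem exists_isHierarchy (P : Finset X) :
    ∃ net loc, net 0 = P ∧ IsHierarchy (X := X) net loc := by
  classical
  obtain ⟨f, h₀, -, hf⟩ := exists_seq_of_step (α := Finset X × (X → X)) (R := fun _ _ => True)
    (T := fun n a b => IsNet ((2 : ℝ) ^ (n + 1)) a.1 b.1 b.2) (a := (P, id)) trivial
    (fun n a _ => by
      obtain ⟨I, z, h⟩ := exists_isNet (r := (2 : ℝ) ^ (n + 1)) (by positivity) a.1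
      exact ⟨(I, z), trivial, h⟩)
  exact ⟨fun n => (f n).1, fun n => (f n).2, by simp [h₀], hf⟩

theorem IsHierarchy.exists_insertion [DecidableEq X] {net : ℕ → Finset X} {loc : ℕ → X → X}
    (h : IsHierarchy net loc) {p : X} {P' : Finset X} (hP : IsInsertion p (net 0) P') :
    ∃ net' loc', net' 0 = P' ∧ IsHierarchy net' loc' ∧ ∀ j, IsInsertion p (net j) (net' j) := by
  obtain ⟨f, h₀, hR, hf⟩ := exists_seq_of_step (α := Finset X × (X → X))
    (R := fun n a => IsInsertion p (net n) a.1)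
    (T := fun n a b => IsNet ((2 : ℝ) ^ (n + 1)) a.1 b.1 b.2) (a := (P', id)) hP
    (fun n a ha => by
      obtain ⟨I, z, h₁, h₂⟩ := (h n).exists_insertion (by positivity) ha
      exact ⟨(I, z), h₂, h₁⟩)
  exact ⟨fun n => (f n).1, fun n => (f n).2, by simp [h₀], hf, hR⟩

/-- The induction closes because the bound `2 ^ (j + 1)` at level `j` is the radius of the net at
level `j + 1`, and repairing that net doubles it. -/
theorem IsHierarchy.exists_deletion [DecidableEq X] {net : ℕ → Finset X} {loc : ℕ → X → X}
    (h : IsHierarchy net loc) {q : X} {P' : Finset X} (hP : IsDeletion q 2 (net 0) P') :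
    ∃ net' loc', net' 0 = P' ∧ IsHierarchy net' loc' ∧
      ∀ j, IsDeletion q ((2 : ℝ) ^ (j + 1)) (net j) (net' j) := by
  obtain ⟨f, h₀, hR, hf⟩ := exists_seq_of_step (α := Finset X × (X → X))
    (R := fun n a => IsDeletion q ((2 : ℝ) ^ (n + 1)) (net n) a.1)
    (T := fun n a b => IsNet ((2 : ℝ) ^ (n + 1)) a.1 b.1 b.2) (a := (P', id)) (by simpa using hP)
    (fun n a ha => by
      obtain ⟨I, z, h₁, h₂⟩ := (h n).exists_deletion (by positivity) ha
      exact ⟨(I, z), by rw [pow_succ']; exact h₂, h₁⟩)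
  exact ⟨fun n => (f n).1, fun n => (f n).2, by simp [h₀], hf, hR⟩

variable {net : ℕ → Finset X} {loc : ℕ → X → X}

theorem IsHierarchy.antitone (h : IsHierarchy net loc) : Antitone net :=
  antitone_nat_of_succ_le fun j => (h j).subset

theorem IsHierarchy.sep (h : IsHierarchy net loc)
    (h₀ : ∀ p ∈ net 0, ∀ q ∈ net 0, p ≠ q → 1 ≤ dist p q) (j : ℕ) :
    ∀ p ∈ net j, ∀ q ∈ net j, p ≠ q → (2 : ℝ) ^ j ≤ dist p q := by
  cases j with
  | zero => simpa using h₀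
  | succ j => exact fun p hp q hq hpq => ((h j).sep p hp q hq hpq).le

/-- A step up costs at most twice the radius, because of the detour through a virtual location; the
costs form a geometric sum. -/
theorem IsHierarchy.exists_dist_le (h : IsHierarchy net loc) (j : ℕ) {p : X} (hp : p ∈ net 0) :
    ∃ s ∈ net j, dist p s ≤ 4 * 2 ^ j := by
  induction j with
  | zero => exact ⟨p, hp, by simp⟩
  | succ j ih =>
    obtain ⟨y, hy, hpy⟩ := ih
    obtain ⟨s, hs, hys⟩ := (h j).covered y hy
    have hys' : dist y s ≤ 2 * 2 ^ (j + 1) := by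
      rcases hys with hys | hys
      · have : (0 : ℝ) ≤ 2 ^ (j + 1) := by positivity
        linarith
      · have := (h j).loc s hs
        rw [dist_comm] at this
        linarith [dist_triangle y (loc (j + 1) s) s]
    refine ⟨s, hs, ?_⟩
    have := dist_triangle p y s
    rw [pow_succ] at hys' ⊢
    linarith

/-- Two points of a high level would be further apart than the diameter of level `0`. -/
theorem IsHierarchy.exists_card_le_one (h : IsHierarchy net loc) : ∃ j, (net j).card ≤ 1 := by
  obtain ⟨M, hM⟩ := Metric.isBounded_iff.1 (net 0).finite_toSet.isBounded
  obtain ⟨j, hj⟩ := pow_unbounded_of_one_lt M (one_lt_two (α := ℝ))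
  refine ⟨j + 1, Finset.card_le_one.2 fun p hp q hq => ?_⟩
  by_contra hpq
  have h₁ := (h j).sep p hp q hq hpq
  have h₂ := hM (h.antitone (Nat.zero_le _) hp) (h.antitone (Nat.zero_le _) hq)
  have h₃ : (2 : ℝ) ^ j ≤ 2 ^ (j + 1) := pow_le_pow_right₀ one_le_two (Nat.le_succ j)
  linarith

end Hierarchy

/-! ### Choosing the centers from a nested sequence -/

/-- `C` is either the whole of `net 0` or a `k`-set between two consecutive sets of `net`, the larger
of which has more than `k` elements. -/
def IsSelection {X : Type*} (k : ℕ) (net : ℕ → Finset X) (C : Finset X) : Prop :=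
  (C = net 0 ∧ C.card ≤ k) ∨
    ∃ i, net (i + 1) ⊆ C ∧ C ⊆ net i ∧ C.card = k ∧ k < (net i).card

/-- The level of a nested sequence at which its sets stop having more than `k` elements. -/
theorem card_le_or_exists_lt_card {X : Type*} {k : ℕ} {net : ℕ → Finset X}
    (hne : ∃ j, (net j).card ≤ k) :
    (net 0).card ≤ k ∨ ∃ i, (net (i + 1)).card ≤ k ∧ k < (net i).card := by
  classical
  rcases h : Nat.find hne with _ | i
  · exact Or.inl (h ▸ Nat.find_spec hne)
  · exact Or.inr ⟨i, h ▸ Nat.find_spec hne, not_le.1 (Nat.find_min hne (by omega))⟩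

theorem exists_isSelection {X : Type*} {k : ℕ} {net : ℕ → Finset X} (hanti : Antitone net)
    (hne : ∃ j, (net j).card ≤ k) :
    ∃ C, IsSelection k net C := by
  rcases card_le_or_exists_lt_card hne with h | ⟨i, h₁, h₂⟩
  · exact ⟨net 0, Or.inl ⟨rfl, h⟩⟩
  · obtain ⟨C, h₃, h₄, h₅⟩ :=
      Finset.exists_subsuperset_card_eq (hanti (Nat.le_succ i)) h₁ h₂.le
    exact ⟨C, Or.inr ⟨i, h₃, h₄, h₅, h₂⟩⟩

section Selection

variable {X : Type*} [DecidableEq X]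

theorem card_symmDiff_le_add {A B : Finset X} {a b : ℕ} (h₁ : (A \ B).card ≤ a)
    (h₂ : (B \ A).card ≤ b) : (symmDiff A B).card ≤ a + b := by
  have : symmDiff A B = (A \ B) ∪ (B \ A) := rfl
  rw [this]
  exact (Finset.card_union_le _ _).trans (add_le_add h₁ h₂)

/-- A `k`-set `C` can be moved between `L` and `U` by at most `m` exchanges if it misses at most `m`
elements of `L` and has at most `m` elements outside `U`. -/
theorem exists_between_card_symmDiff_le {k m : ℕ} {L U C : Finset X} (hLU : L ⊆ U)
    (hL : L.card ≤ k) (hU : k ≤ U.card) (hC : C.card = k) (hLC : (L \ C).card ≤ m)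
    (hCU : (C \ U).card ≤ m) :
    ∃ C', L ⊆ C' ∧ C' ⊆ U ∧ C'.card = k ∧ (symmDiff C C').card ≤ 2 * m := by
  have key : ∀ C' : Finset X, C'.card = k → ((C' \ C).card ≤ m ∨ (C \ C').card ≤ m) →
      (symmDiff C C').card ≤ 2 * m := by
    intro C' hC' hor
    have h : (C \ C').card = (C' \ C).card := Finset.card_sdiff_comm (hC.trans hC'.symm)
    rw [two_mul]
    rcases hor with hor | hor
    · exact card_symmDiff_le_add (h ▸ hor) hor
    · exact card_symmDiff_le_add hor (h ▸ hor)
  have hMU : L ∪ C ∩ U ⊆ U := Finset.union_subset hLU Finset.inter_subset_right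
  -- If this union is large, shrinking it adds to `C` only elements of `L \ C`; if small, enlarging
  -- it removes from `C` only elements of `C \ U`. Equal cardinalities bound the other difference.
  rcases le_total k (L ∪ C ∩ U).card with hM | hM
  · obtain ⟨C', h₁, h₂, h₃⟩ :=
      Finset.exists_subsuperset_card_eq Finset.subset_union_left hL hM
    refine ⟨C', h₁, h₂.trans hMU, h₃, key C' h₃ (Or.inl ((Finset.card_le_card ?_).trans hLC))⟩
    intro x hx
    have := @h₂ x
    simp only [Finset.mem_sdiff, Finset.mem_union, Finset.mem_inter] at *
    tauto
  · obtain ⟨C', h₁, h₂, h₃⟩ := Finset.exists_subsuperset_card_eq hMU hM hU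
    refine ⟨C', Finset.subset_union_left.trans h₁, h₂, h₃,
      key C' h₃ (Or.inr ((Finset.card_le_card ?_).trans hCU))⟩
    intro x hx
    have := @h₁ x
    simp only [Finset.mem_sdiff, Finset.mem_union, Finset.mem_inter] at *
    tauto

variable {k : ℕ} {net net' : ℕ → Finset X}

theorem card_sdiff_le_of_subset_insert {A B : Finset X} {p : X} (h : A ⊆ insert p B) :
    (A \ B).card ≤ 1 := by
  have : A \ B ⊆ {p} := by
    intro x hx
    rw [Finset.mem_sdiff] at hx
    simpa using (Finset.mem_insert.1 (h hx.1)).resolve_right hx.2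
  simpa using Finset.card_le_card this

theorem card_sdiff_le_of_erase_subset {A B : Finset X} {q : X} (h : A.erase q ⊆ B) :
    (A \ B).card ≤ 1 := by
  have : A \ B ⊆ {q} := by
    intro x hx
    rw [Finset.mem_sdiff] at hx
    by_contra hxq
    exact hx.2 (h (Finset.mem_erase.2 ⟨by simpa using hxq, hx.1⟩))
  simpa using Finset.card_le_card this

theorem subset_of_subset_insert_of_card_lt {A B : Finset X} {p : X} (h : A ⊆ insert p B)
    (hc : B.card < A.card) : B ⊆ A := by
  have := Finset.eq_of_subset_of_card_le h ((Finset.card_insert_le _ _).trans hc)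
  rw [this]
  exact Finset.subset_insert _ _

/-- Levels only grow, so the level where sizes cross `k` cannot move down. If it moves up, the new
upper set lies in `insert p C` and has more than `k` elements, hence contains `C`. -/
theorem IsSelection.exists_insertion {C : Finset X} {p : X} (hC : IsSelection k net C)
    (hanti' : Antitone net') (hne : ∃ j, (net' j).card ≤ k)
    (h : ∀ j, IsInsertion p (net j) (net' j)) :
    ∃ C', IsSelection k net' C' ∧ (symmDiff C C').card ≤ 2 := by
  -- it suffices to know that the new bounding sets differ from `C` by `p` only
  have main : ∀ i, (net' (i + 1)).card ≤ k → k < (net' i).card → C.card = k →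
      net' (i + 1) ⊆ insert p C → C ⊆ net' i →
      ∃ C', IsSelection k net' C' ∧ (symmDiff C C').card ≤ 2 := by
    intro i h₁ h₂ h₃ h₄ h₅
    obtain ⟨C', h₆, h₇, h₈, h₉⟩ := exists_between_card_symmDiff_le (m := 1)
      (hanti' (Nat.le_succ i)) h₁ h₂.le h₃ (card_sdiff_le_of_subset_insert h₄)
      (by rw [Finset.sdiff_eq_empty_iff_subset.2 h₅]; simp)
    exact ⟨C', Or.inr ⟨i, h₆, h₇, h₈, h₂⟩, h₉⟩
  rcases hC with ⟨rfl, hk⟩ | ⟨i, h₁, h₂, h₃, h₄⟩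
  · rcases card_le_or_exists_lt_card hne with h' | ⟨i', h₁', h₂'⟩
    · refine ⟨net' 0, Or.inl ⟨rfl, h'⟩, ?_⟩
      have := card_symmDiff_le_add (a := 0) (b := 1) (A := net 0) (B := net' 0)
        (by rw [Finset.sdiff_eq_empty_iff_subset.2 (h 0).1]; simp)
        (card_sdiff_le_of_subset_insert (h 0).2)
      omega
    · have hsub : net' i' ⊆ insert p (net 0) := (hanti' (Nat.zero_le _)).trans (h 0).2
      have hcard := (Finset.card_le_card hsub).trans (Finset.card_insert_le _ _)
      exact main i' h₁' h₂' (by omega) ((hanti' (Nat.le_succ i')).trans hsub)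
        (subset_of_subset_insert_of_card_lt hsub (by omega))
  · have hgt : ∀ l ≤ i, k < (net' l).card := fun l hl =>
      h₄.trans_le ((Finset.card_le_card (h i).1).trans (Finset.card_le_card (hanti' hl)))
    rcases card_le_or_exists_lt_card hne with h' | ⟨i', h₁', h₂'⟩
    · exact absurd h' (not_le.2 (hgt 0 (Nat.zero_le _)))
    have hi : i ≤ i' := by
      by_contra hlt
      exact absurd h₁' (not_le.2 (hgt (i' + 1) (by omega)))
    have hsub : net' (i + 1) ⊆ insert p C := (h (i + 1)).2.trans (Finset.insert_subset_insert p h₁)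
    refine main i' h₁' h₂' h₃ ((hanti' (by omega)).trans hsub) ?_
    rcases hi.eq_or_lt with rfl | hi
    · exact h₂.trans (h i).1
    · exact subset_of_subset_insert_of_card_lt ((hanti' hi).trans hsub) (by omega)

theorem IsSelection.exists_deletion {C : Finset X} {q : X} (hC : IsSelection k net C)
    (hanti : Antitone net) (hanti' : Antitone net') (hne : ∃ j, (net' j).card ≤ k)
    (h₀ : net' 0 ⊆ net 0) (he : ∀ j, (net j).erase q ⊆ net' j)
    (hc : ∀ j, (net' j \ net j).card ≤ 2) :
    ∃ C', IsSelection k net' C' ∧ (symmDiff C C').card ≤ 4 := by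
  rcases hC with ⟨rfl, hk⟩ | ⟨i, h₁, h₂, h₃, h₄⟩
  · refine ⟨net' 0, Or.inl ⟨rfl, (Finset.card_le_card h₀).trans hk⟩, ?_⟩
    have := card_symmDiff_le_add (card_sdiff_le_of_erase_subset (he 0)) (hc 0)
    omega
  -- a level at or above the old one whose new set has at most `k` elements
  have hdrop : ∀ l ≤ i, (net' l).card ≤ k → (net' l \ C).card ≤ 1 := by
    intro l hl hcard
    have hCl : C ⊆ net l := h₂.trans (hanti hl)
    -- The size drops from above `k` to at most `k`, so only `q` was lost and `net l` had exactly `k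
    -- + 1` elements, one of them outside `C`.
    have hlk : k < (net l).card := h₄.trans_le (Finset.card_le_card (hanti hl))
    have h₅ := Finset.pred_card_le_card_erase (s := net l) (a := q)
    have h₆ : (net l).erase q = net' l := Finset.eq_of_subset_of_card_le (he l) (by omega)
    have h₇ : net' l \ C ⊆ net l \ C :=
      Finset.sdiff_subset_sdiff (h₆ ▸ Finset.erase_subset _ _) subset_rfl
    have h₈ := Finset.card_le_card h₇
    have h₉ : (net l).card ≤ k + 1 := by rw [h₆] at h₅; omega
    rw [Finset.card_sdiff_of_subset hCl] at h₈
    omega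
  have hout : ∀ l ≤ i, (C \ net' l).card ≤ 1 := fun l hl =>
    card_sdiff_le_of_erase_subset
      ((Finset.erase_subset_erase q (h₂.trans (hanti hl))).trans (he l))
  rcases card_le_or_exists_lt_card hne with h' | ⟨i', h₁', h₂'⟩
  · refine ⟨net' 0, Or.inl ⟨rfl, h'⟩, ?_⟩
    have := card_symmDiff_le_add (hout 0 (Nat.zero_le _)) (hdrop 0 (Nat.zero_le _) h')
    omega
  have hsub : ∀ l, i + 1 ≤ l → (net' l \ C).card ≤ 2 := fun l hl =>
    (Finset.card_le_card (Finset.sdiff_subset_sdiff (hanti' hl) h₁)).trans (hc (i + 1))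
  have hL : (net' (i' + 1) \ C).card ≤ 2 := by
    rcases lt_or_ge i' i with hi | hi
    · exact (hdrop (i' + 1) hi h₁').trans one_le_two
    · exact hsub (i' + 1) (by omega)
  have hU : (C \ net' i').card ≤ 2 := by
    rcases le_or_gt i' i with hi | hi
    · exact (hout i' hi).trans one_le_two
    -- More than `k` elements with at most two outside `C` leave at most one element of `C` missing.
    · have h₅ := hsub i' hi
      have h₆ := Finset.card_sdiff_add_card_inter (net' i') C
      have h₇ := Finset.card_sdiff_add_card_inter C (net' i')
      rw [Finset.inter_comm] at h₇
      omega
  obtain ⟨C', h₅, h₆, h₇, h₈⟩ := exists_between_card_symmDiff_le (m := 2)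
    (hanti' (Nat.le_succ i')) h₁' h₂'.le h₃ hL hU
  exact ⟨C', Or.inr ⟨i', h₅, h₆, h₇, h₂'⟩, h₈⟩

end Selection

/-! ### Cost of the selected centers -/

section Cost

variable {X : Type*} [MetricSpace X]

/-- More than `k` points of `P` that are pairwise at least `r` apart force a cost of `r / 2`. -/
theorem ofReal_half_le_opt {k : ℕ} {r : ℝ} {P W : Finset X} (hWP : W ⊆ P) (hW : k < W.card)
    (hsep : ∀ p ∈ W, ∀ q ∈ W, p ≠ q → r ≤ dist p q) : ENNReal.ofReal (r / 2) ≤ opt k P := by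
  refine le_iInf₂ fun D hD => ?_
  by_contra hlt
  rw [not_le] at hlt
  have hnear : ∀ p ∈ W, ∃ c ∈ D, dist p c < r / 2 := by
    intro p hp
    have h₁ : Metric.infEDist p (D : Set X) < ENNReal.ofReal (r / 2) :=
      (le_iSup₂ (f := fun p (_ : p ∈ P) => Metric.infEDist p (D : Set X)) p (hWP hp)).trans_lt hlt
    obtain ⟨c, hc, hpc⟩ := Metric.infEDist_lt_iff.1 h₁
    rw [edist_dist, ENNReal.ofReal_lt_ofReal_iff_of_nonneg dist_nonneg] at hpc
    exact ⟨c, hc, hpc⟩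
  choose! f hfD hf using hnear
  obtain ⟨p, hp, q, hq, hpq, he⟩ :=
    Finset.exists_ne_map_eq_of_card_lt_of_maps_to (hD.trans_lt hW) hfD
  have h₁ := hf p hp
  have h₂ := hf q hq
  rw [← he, dist_comm] at h₂
  linarith [hsep p hp q hq hpq, dist_triangle p (f p) q]

theorem IsSelection.cost_le {k : ℕ} {net : ℕ → Finset X} {loc : ℕ → X → X} {C : Finset X}
    (hC : IsSelection k net C) (h : IsHierarchy net loc)
    (h₀ : ∀ p ∈ net 0, ∀ q ∈ net 0, p ≠ q → 1 ≤ dist p q) :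
    cost (net 0) C ≤ 24 * opt k (net 0) := by
  rcases hC with ⟨rfl, -⟩ | ⟨i, h₁, -, -, h₄⟩
  · refine iSup₂_le fun p hp => ?_
    rw [Metric.infEDist_zero_of_mem (Finset.mem_coe.2 hp)]
    exact zero_le
  · have hopt := ofReal_half_le_opt (h.antitone (Nat.zero_le i)) h₄ (h.sep h₀ i)
    calc cost (net 0) C ≤ ENNReal.ofReal (4 * 2 ^ (i + 1)) := by
          refine iSup₂_le fun p hp => ?_
          obtain ⟨s, hs, hps⟩ := h.exists_dist_le (i + 1) hp
          refine (Metric.infEDist_le_edist_of_mem (Finset.mem_coe.2 (h₁ hs))).trans ?_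
          rw [edist_dist]
          exact ENNReal.ofReal_le_ofReal hps
      _ ≤ ENNReal.ofReal (24 * (2 ^ i / 2)) := by
          -- The left side is `16 * (2 ^ i / 2)`, so `24` leaves slack.
          refine ENNReal.ofReal_le_ofReal ?_
          have : (0 : ℝ) ≤ 2 ^ i := by positivity
          rw [pow_succ]
          linarith
      _ = 24 * ENNReal.ofReal (2 ^ i / 2) := by
          rw [ENNReal.ofReal_mul (by norm_num)]
          norm_num
      _ ≤ 24 * opt k (net 0) := by gcongr

end Cost

/-! ### The dynamic algorithm -/

/-- The data kept by the algorithm: a hierarchy of nets with virtual locations and the centers. -/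
structure State (X : Type*) where
  net : ℕ → Finset X
  loc : ℕ → X → X
  centers : Finset X

instance {X : Type*} : Inhabited (State X) := ⟨⟨fun _ => ∅, fun _ => id, ∅⟩⟩

/-- The invariant kept by the algorithm for the current point set `P`. -/
structure State.IsValid {X : Type*} [MetricSpace X] (k : ℕ) (P : Finset X) (s : State X) :
    Prop where
  net_zero : s.net 0 = P
  isHierarchy : IsHierarchy s.net s.loc
  isSelection : IsSelection k s.net s.centers

theorem exists_isValid {X : Type*} [MetricSpace X] {k : ℕ} (hk : 1 ≤ k) (P : Finset X) :
    ∃ s : State X, s.IsValid k P := by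
  obtain ⟨net, loc, h₀, h⟩ := exists_isHierarchy P
  obtain ⟨C, hC⟩ := exists_isSelection h.antitone (h.exists_card_le_one.imp fun _ hj => hj.trans hk)
  exact ⟨⟨net, loc, C⟩, h₀, h, hC⟩

section Algorithm

variable {X : Type*} [MetricSpace X] [DecidableEq X]

/-- `s'` is an admissible successor of `s` when the point set changes from `P` to `P'`. -/
structure IsStep (k : ℕ) (P P' : Finset X) (s s' : State X) : Prop where
  isValid : s'.IsValid k P'
  insertion : (P' \ P).Nonempty → (symmDiff s.centers s'.centers).card ≤ 2
  deletion : (P \ P').Nonempty → (symmDiff s.centers s'.centers).card ≤ 4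

theorem State.IsValid.exists_isStep {k : ℕ} (hk : 1 ≤ k) {P P' : Finset X} {s : State X}
    (hs : s.IsValid k P) (hP : (symmDiff P P').card = 1) : ∃ s', IsStep k P P' s s' := by
  obtain ⟨x, hx⟩ := Finset.card_eq_one.1 hP
  have hmem : ∀ y, (y ∈ P ∧ y ∉ P' ∨ y ∈ P' ∧ y ∉ P) ↔ y = x := fun y => by
    rw [← Finset.mem_symmDiff, hx, Finset.mem_singleton]
  by_cases hxP : x ∈ P
  · have hsub : P' ⊆ P := fun y hy => by
      by_contra hyP
      exact hyP ((hmem y).1 (Or.inr ⟨hy, hyP⟩) ▸ hxP)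
    have hdel : IsDeletion x 2 (s.net 0) P' := by
      rw [hs.net_zero]
      refine ⟨fun y hy => ?_, ?_, ?_, ?_⟩
      · by_contra hyP'
        exact Finset.ne_of_mem_erase hy ((hmem y).1 (Or.inl ⟨Finset.mem_of_mem_erase hy, hyP'⟩))
      · have := (hmem x).2 rfl
        tauto
      · simp [Finset.sdiff_eq_empty_iff_subset.2 hsub]
      · simp [Finset.sdiff_eq_empty_iff_subset.2 hsub]
    obtain ⟨net', loc', h₀, h, hj⟩ := hs.isHierarchy.exists_deletion hdel
    obtain ⟨C', hC', hcard⟩ := hs.isSelection.exists_deletion hs.isHierarchy.antitone h.antitone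
      (h.exists_card_le_one.imp fun _ hj => hj.trans hk) (by rw [h₀, hs.net_zero]; exact hsub)
      (fun j => (hj j).erase_subset) (fun j => (hj j).card_le)
    refine ⟨⟨net', loc', C'⟩, ⟨h₀, h, hC'⟩, fun hne => ?_, fun _ => hcard⟩
    simp [Finset.sdiff_eq_empty_iff_subset.2 hsub] at hne
  · have hsub : P ⊆ P' := fun y hy => by
      by_contra hyP'
      exact hxP ((hmem y).1 (Or.inl ⟨hy, hyP'⟩) ▸ hy)
    have hins : IsInsertion x (s.net 0) P' := by
      rw [hs.net_zero]
      refine ⟨hsub, fun y hy => ?_⟩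
      by_cases hyP : y ∈ P
      · exact Finset.mem_insert_of_mem hyP
      · rw [(hmem y).1 (Or.inr ⟨hy, hyP⟩)]
        exact Finset.mem_insert_self _ _
    obtain ⟨net', loc', h₀, h, hj⟩ := hs.isHierarchy.exists_insertion hins
    obtain ⟨C', hC', hcard⟩ := hs.isSelection.exists_insertion h.antitone
      (h.exists_card_le_one.imp fun _ hj => hj.trans hk) hj
    exact ⟨⟨net', loc', C'⟩, ⟨h₀, h, hC'⟩, fun _ => hcard, fun _ => hcard.trans (by norm_num)⟩

/-- The state of the algorithm after processing `P 1, …, P i`. -/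
noncomputable def run (k : ℕ) (P : ℕ → Finset X) : ℕ → State X
  | 0 => default
  | 1 => Classical.epsilon (State.IsValid k (P 1))
  | i + 2 => Classical.epsilon (IsStep k (P (i + 1)) (P (i + 2)) (run k P (i + 1)))

/-- Each choice depends only on the preceding state and the last two point sets, so the rule is
online. -/
theorem run_congr (k : ℕ) {P Q : ℕ → Finset X} :
    ∀ i, (∀ j, 1 ≤ j → j ≤ i → P j = Q j) → run k P i = run k Q i
  | 0, _ => by rw [run, run]
  | 1, h => by rw [run, run, h 1 le_rfl le_rfl]
  | i + 2, h => by
    rw [run, run, h (i + 1) (by omega) (by omega), h (i + 2) (by omega) le_rfl,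
      run_congr k (i + 1) fun j h₁ h₂ => h j h₁ (by omega)]

theorem isValid_run {k n : ℕ} (hk : 1 ≤ k) {P : ℕ → Finset X}
    (hP : ∀ i, 1 ≤ i → i < n → (symmDiff (P i) (P (i + 1))).card = 1) :
    ∀ i, i + 1 ≤ n → (run k P (i + 1)).IsValid k (P (i + 1))
  | 0, _ => by
    rw [run]
    exact Classical.epsilon_spec (exists_isValid hk (P 1))
  | i + 1, h => by
    rw [run]
    exact (Classical.epsilon_spec
      ((isValid_run hk hP i (by omega)).exists_isStep hk (hP (i + 1) (by omega) (by omega)))).isValid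

theorem isStep_run {k n : ℕ} (hk : 1 ≤ k) {P : ℕ → Finset X}
    (hP : ∀ i, 1 ≤ i → i < n → (symmDiff (P i) (P (i + 1))).card = 1) (i : ℕ) (h : i + 1 < n) :
    IsStep k (P (i + 1)) (P (i + 2)) (run k P (i + 1)) (run k P (i + 2)) := by
  rw [run]
  exact Classical.epsilon_spec
    ((isValid_run hk hP i h.le).exists_isStep hk (hP (i + 1) (by omega) h))

end Algorithm

theorem IsSelection.subset {X : Type*} {k : ℕ} {net : ℕ → Finset X} {C : Finset X}
    (hC : IsSelection k net C) (hanti : Antitone net) : C ⊆ net 0 := by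
  rcases hC with ⟨rfl, -⟩ | ⟨i, -, h, -⟩
  · exact subset_rfl
  · exact h.trans (hanti (Nat.zero_le i))

theorem IsSelection.card_le {X : Type*} {k : ℕ} {net : ℕ → Finset X} {C : Finset X}
    (hC : IsSelection k net C) : C.card ≤ k := by
  rcases hC with ⟨-, h⟩ | ⟨i, -, -, h, -⟩
  · exact h
  · exact h.le

theorem cost_empty_le {X : Type*} [MetricSpace X] (P : Finset X) :
    cost P ∅ ≤ 24 * opt 0 P := by
  have h : cost P ∅ ≤ opt 0 P := le_iInf₂ fun D hD => by
    rw [Finset.card_eq_zero.1 (Nat.le_zero.1 hD)]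
  exact h.trans (le_mul_of_one_le_left zero_le (by norm_num))

end DynamicKCenter

open DynamicKCenter

theorem theorem2 {X : Type*} [MetricSpace X] [DecidableEq X] (k Δ : ℕ) :
    ∃ C : (ℕ → Finset X) → ℕ → Finset X,
      -- the `i`-th set of centers is determined by `P 1, …, P i`
      (∀ (P Q : ℕ → Finset X) (i : ℕ),
        (∀ j, 1 ≤ j → j ≤ i → P j = Q j) → C P i = C Q i) ∧
      ∀ (n : ℕ) (P : ℕ → Finset X), DynamicKCenter.IsUpdateSequence Δ n P →
        (∀ i, 1 ≤ i → i ≤ n →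
          C P i ⊆ P i ∧ (C P i).card ≤ k ∧
            DynamicKCenter.cost (P i) (C P i) ≤ 24 * DynamicKCenter.opt k (P i)) ∧
        (∀ i, 1 ≤ i → i < n →
          ((P (i + 1) \ P i).Nonempty → (symmDiff (C P i) (C P (i + 1))).card ≤ 2) ∧
          ((P i \ P (i + 1)).Nonempty → (symmDiff (C P i) (C P (i + 1))).card ≤ 4)) := by
  -- For `k = 0` no level need ever be small enough, since nets of nonempty sets are nonempty; the
  -- empty set is then the only candidate and is optimal.
  rcases Nat.eq_zero_or_pos k with rfl | hk
  · exact ⟨fun _ _ => ∅, fun _ _ _ _ => rfl, fun n P _ =>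
      ⟨fun i _ _ => ⟨Finset.empty_subset _, le_rfl, cost_empty_le _⟩, fun i _ _ => by simp⟩⟩
  refine ⟨fun P i => (run k P i).centers, fun P Q i h => by simp only [run_congr k i h],
    fun n P hP => ⟨fun i h₁ hn => ?_, fun i h₁ hn => ?_⟩⟩
  · obtain ⟨i, rfl⟩ := Nat.exists_eq_add_of_le' h₁
    have hv := isValid_run hk hP.card_symmDiff i hn
    have hsub := hv.isSelection.subset hv.isHierarchy.antitone
    have hcost := hv.isSelection.cost_le hv.isHierarchy
      (by rw [hv.net_zero]; exact hP.one_le_dist (i + 1) h₁ hn)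
    rw [hv.net_zero] at hsub hcost
    exact ⟨hsub, hv.isSelection.card_le, hcost⟩
  · obtain ⟨i, rfl⟩ := Nat.exists_eq_add_of_le' h₁
    have hs := isStep_run hk hP.card_symmDiff i hn
    exact ⟨hs.insertion, hs.deletion⟩
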